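/- Let $G$ be a discrete group, let $U:G\to\mathcal B(\ell^2(G))$ be its left regular representation, and let $\mathcal A=C^*\{U_x:x\in G\}\subseteq\mathcal B(\ell^2(G))$ be the reduced group $C^*$-algebra of $G$. Call a linear map $T:\mathcal A\to\mathcal A$ a locally finite contraction if $\|T\|\le 1$ and, for every $a\in\mathcal A$, the norm closure of the orbit $\{a,Ta,T^2a,\dots\}$ is compact. Let $\rho$ be a state of $\mathcal A$. Then there is a unique completely positive linear map $P:\mathcal A\to\mathcal A$ satisfying $$P(U_x)=\rho(U_x)U_x,\qquad x\in G,$$ and $P$ is a locally finite contraction. Let $\mathcal B$ be the $C^*$-subalgebra of $\mathcal A$ generated by $\{U_x:|\rho(U_x)|=1\}$. Then: (i) The restriction $\alpha$ of $P$ to $\mathcal B$ is a $*$-automorphism of $\mathcal B$. (ii) There is a unique completely positive linear map $E:\mathcal A\to\mathcal A$ such that, for every $x\in G$, $E(U_x)=U_x$ if $|\rho(U_x)|=1$ and $E(U_x)=0$ if $|\rho(U_x)|<1$. Moreover $E$ is idempotent, $E\circ E=E$, with range $\mathcal B$. (iii) For every $A\in\mathcal A$, $$\lim_{n\to\infty}\|P^n(A)-\alpha^n(E(A))\|=0.$$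 -/

import Mathlib

open scoped lp ENNReal ComplexOrder CStarAlgebra
open Filter Topology

noncomputable section

namespace ReducedGroup

/-- A linear map `T` on a complex Banach space is a *locally finite contraction* if `‖T x‖ ≤ ‖x‖`
for all `x` (that is, `‖T‖ ≤ 1`) and the orbit `{x, T x, T² x, …}` of every vector `x` has compact
norm closure. -/
def IsLocallyFiniteContraction {X : Type*} [NormedAddCommGroup X] [NormedSpace ℂ X]
    [CompleteSpace X] (T : X →ₗ[ℂ] X) : Prop :=
  (∀ x, ‖T x‖ ≤ ‖x‖) ∧ ∀ x, IsCompact (closure (Set.range fun n : ℕ => (T ^ n) x))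

variable (G : Type*) [Group G]

variable {G} in
lemma memlp_translate (x : G) (f : ℓ²(G, ℂ)) :
    Memℓp (fun y : G => (f : G → ℂ) (x⁻¹ * y)) 2 := by
  have h := (memℓp_gen_iff (by norm_num : 0 < (2 : ℝ≥0∞).toReal)).1 (lp.memℓp f)
  exact memℓp_gen (h.comp_injective (mul_right_injective x⁻¹))

variable {G} in
/-- Left translation by `x` on `ℓ²(G)`, as an isometry: `(U_x f)(y) = f (x⁻¹ y)`. -/
def translate (x : G) : ℓ²(G, ℂ) →ₗᵢ[ℂ] ℓ²(G, ℂ) where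
  toFun f := ⟨fun y => (f : G → ℂ) (x⁻¹ * y), memlp_translate x f⟩
  map_add' _ _ := rfl
  map_smul' _ _ := rfl
  norm_map' f := by
    have h2 : 0 < (2 : ℝ≥0∞).toReal := by norm_num
    rw [lp.norm_eq_tsum_rpow h2, lp.norm_eq_tsum_rpow h2]
    congr 1
    exact (Equiv.mulLeft x⁻¹).tsum_eq fun y => ‖(f : G → ℂ) y‖ ^ (2 : ℝ≥0∞).toReal

/-- The left regular representation of the discrete group `G` on `ℓ²(G)`,
`(U_x f)(y) = f (x⁻¹ y)`. -/
def regularRep : G →* (ℓ²(G, ℂ) →L[ℂ] ℓ²(G, ℂ)) where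
  toFun x := (translate x).toContinuousLinearMap
  map_one' := by
    ext f y
    change (f : G → ℂ) (1⁻¹ * y) = (f : G → ℂ) y
    simp
  map_mul' x z := by
    ext f y
    change (f : G → ℂ) ((x * z)⁻¹ * y) = (f : G → ℂ) (z⁻¹ * (x⁻¹ * y))
    rw [mul_inv_rev, mul_assoc]

/-- The reduced group C⋆-algebra of `G`: the norm-closed unital star subalgebra of the bounded
operators on `ℓ²(G)` generated by the operators of the left regular representation. -/
def reducedCStarAlgebra : StarSubalgebra ℂ (ℓ²(G, ℂ) →L[ℂ] ℓ²(G, ℂ)) :=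
  (StarAlgebra.adjoin ℂ (Set.range (regularRep G))).topologicalClosure

instance isClosed_reducedCStarAlgebra :
    IsClosed (reducedCStarAlgebra G : Set (ℓ²(G, ℂ) →L[ℂ] ℓ²(G, ℂ))) :=
  StarSubalgebra.isClosed_topologicalClosure _

/-- The order inherited from the (Loewner) order of bounded operators on `ℓ²(G)` is the usual
order of the C⋆-algebra: the positive elements are the sums of the elements `s⋆ s`. -/
instance starOrderedRing_reducedCStarAlgebra : StarOrderedRing (reducedCStarAlgebra G) :=
  StarOrderedRing.of_nonneg_iff' (fun {x y} h z => by
      change (z : ℓ²(G, ℂ) →L[ℂ] ℓ²(G, ℂ)) + x ≤ z + y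
      exact add_le_add_right h _) (fun a => by
    constructor
    · intro ha
      have ha' : (0 : ℓ²(G, ℂ) →L[ℂ] ℓ²(G, ℂ)) ≤ a := ha
      have hs : IsSelfAdjoint a := Subtype.ext (IsSelfAdjoint.of_nonneg ha').star_eq
      have hr : SpectrumRestricts a ContinuousMap.realToNNReal := by
        have h := SpectrumRestricts.nnreal_of_nonneg ha'
        rw [SpectrumRestricts.nnreal_iff] at h ⊢
        intro t ht
        refine h t ?_
        rw [← spectrum.algebraMap_mem_iff ℂ] at ht ⊢
        rwa [StarSubalgebra.spectrum_eq (hS := isClosed_reducedCStarAlgebra G)] at ht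
      obtain ⟨s, hs₁, -, hs₂⟩ := CFC.exists_sqrt_of_isSelfAdjoint_of_quasispectrumRestricts hs hr
      exact ⟨s, by rw [hs₁.star_eq, hs₂]⟩
    · rintro ⟨s, rfl⟩
      change (0 : ℓ²(G, ℂ) →L[ℂ] ℓ²(G, ℂ)) ≤ star (s : ℓ²(G, ℂ) →L[ℂ] ℓ²(G, ℂ)) * s
      exact star_mul_self_nonneg _)

variable {G}

/-- The unitary `U_x`, as an element of the reduced group C⋆-algebra. -/
def U (x : G) : reducedCStarAlgebra G :=
  ⟨regularRep G x, StarSubalgebra.le_topologicalClosure _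
    (StarAlgebra.subset_adjoin ℂ _ (Set.mem_range_self x))⟩

/-- The C⋆-subalgebra of the reduced group C⋆-algebra generated by the `U_x` with `|ρ(U_x)| = 1`.
(For a state `ρ` the unit `U_1 = 1` is one of these generators.) -/
def peripheralSubalgebra (ρ : reducedCStarAlgebra G →ₚ[ℂ] ℂ) :
    StarSubalgebra ℂ (reducedCStarAlgebra G) :=
  (StarAlgebra.adjoin ℂ {a | ∃ x : G, ‖ρ (U x)‖ = 1 ∧ U x = a}).topologicalClosure

end ReducedGroup

end

open ReducedGroup

/-!
A normalized positive definite function `φ` on `G` is a Gram kernel: there are functions `vᵢ` with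
`φ (x⁻¹ y) = ∑ᵢ conj (vᵢ x) vᵢ y`. The multiplication operators by the `vᵢ` are the components of an
isometry `V`, and the compression `a ↦ V⋆ (1 ⊗ a) V` is a completely positive contraction that
scales `U x` by `φ x`. The coefficients `x ↦ ρ (U x)` of a state `ρ` form such a function. Where
`|φ x| = 1`, equality holds in the Cauchy-Schwarz inequality, so that `φ (y x) = φ y φ x` for all
`y`. Hence these `x` form a subgroup `N`, and the multiplier is multiplicative on its algebra, with
the multiplier by the conjugate of `φ` as inverse there. The indicator function of `N` is positive
definite too, and its multiplier is `E`. Each `U x` is an eigenvector of `P`, with an eigenvalue of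
modulus one for `x` in `N` and of modulus less than one otherwise; since all maps involved are
contractions, the statements about orbits and limits pass from the `U x` to their closed span.
-/

open scoped InnerProductSpace InnerProduct

noncomputable section

namespace ReducedGroup

universe u

section GramMatrix

variable {X : Type u}

theorem posSemidef_gram {E : Type*} [SeminormedAddCommGroup E] [InnerProductSpace ℂ E]
    (ξ : X → E) : (Matrix.gram ℂ ξ).PosSemidef := by
  refine ⟨Matrix.isHermitian_gram ℂ ξ, fun c => ?_⟩
  have h : (c.sum fun x a => c.sum fun y b => star a * Matrix.gram ℂ ξ x y * b) =
      ⟪c.sum fun x a => a • ξ x, c.sum fun x a => a • ξ x⟫_ℂ := by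
    simp only [Finsupp.sum, sum_inner, inner_sum, inner_smul_left, inner_smul_right,
      Matrix.gram_apply, Complex.star_def, Finset.mul_sum]
    rw [Finset.sum_comm]
    exact Finset.sum_congr rfl fun y _ => Finset.sum_congr rfl fun x _ => by ring
  rw [h, inner_self_eq_norm_sq_to_K]
  positivity

theorem exists_gram_eq {M : Matrix X X ℂ} (hM : M.PosSemidef) :
    ∃ (H : Type u) (_ : NormedAddCommGroup H) (_ : InnerProductSpace ℂ H)
      (_ : CompleteSpace H) (ξ : X → H), Matrix.gram ℂ ξ = M := by
  let K : Matrix X X (ℂ →L[ℂ] ℂ) := M.map fun z => z • 1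
  have inner_K (x y : X) (a b : ℂ) : ⟪K x y a, b⟫_ℂ = star (star b * M x y * a) := by
    simp [K, mul_comm, mul_left_comm]
  have hK : K.PosSemidef := by
    have posSemidef_iff := (RKHS.posSemidef_tfae (K := K)).out 0 2
    refine posSemidef_iff.2 ⟨?_, fun c => ?_⟩
    · ext x y
      simp [K, ← hM.1.apply x y]
    · simp only [inner_K]
      rw [Finsupp.sum_comm]
      have := (Complex.nonneg_iff.1 (star_nonneg_iff.2 (hM.2 c))).1
      simpa only [star_finsuppSum, Pi.star_apply, RCLike.re_to_complex] using this
  have : Fact K.PosSemidef := ⟨hK⟩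
  refine ⟨RKHS.OfKernel K, inferInstance, inferInstance, inferInstance,
    fun x => RKHS.kerFun (RKHS.OfKernel K) x 1, ?_⟩
  ext x y
  rw [Matrix.gram_apply, ← RKHS.kernel_inner, RKHS.OfKernel.kernel_ofKernel, inner_K, star_one,
    one_mul, mul_one]
  exact hM.1.apply x y

theorem exists_hasSum_star_mul {M : Matrix X X ℂ} (hM : M.PosSemidef) :
    ∃ (ι : Type u) (v : ι → X → ℂ), ∀ x y, HasSum (fun i => star (v i x) * v i y) (M x y) := by
  obtain ⟨H, _, _, _, ξ, rfl⟩ := exists_gram_eq hM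
  obtain ⟨s, e, -⟩ := exists_hilbertBasis ℂ H
  refine ⟨s, fun i x => ⟪e i, ξ x⟫_ℂ, fun x y => ?_⟩
  simpa using e.hasSum_inner_mul_inner (ξ x) (ξ y)

theorem posSemidef_map_star_mul {A : Type*} [CStarAlgebra A] [PartialOrder A] [StarOrderedRing A]
    (f : A →ₚ[ℂ] ℂ) (a : X → A) : (Matrix.of fun x y => f (star (a x) * a y)).PosSemidef := by
  convert posSemidef_gram fun x => f.toPreGNS (a x) using 1
  ext x y
  rw [Matrix.of_apply, Matrix.gram_apply, PositiveLinearMap.preGNS_inner_def,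
    PositiveLinearMap.ofPreGNS_toPreGNS, PositiveLinearMap.ofPreGNS_toPreGNS]

end GramMatrix

section PositiveDefinite

variable {G : Type u} [Group G]

/-- Positive definite functions on a group with value `1` at the identity. Positive definiteness is
positive semidefiniteness of the (possibly infinite) matrix `φ (x⁻¹ y)`, which Mathlib tests on
finitely supported vectors. -/
structure IsNormalizedPosDef (φ : G → ℂ) : Prop where
  map_one : φ 1 = 1
  posSemidef : (Matrix.of fun x y => φ (x⁻¹ * y)).PosSemidef

theorem isNormalizedPosDef_indicator (N : Subgroup G) :
    IsNormalizedPosDef ((N : Set G).indicator (1 : G → ℂ)) where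
  map_one := Set.indicator_of_mem N.one_mem 1
  posSemidef := by
    classical
    convert (Matrix.PosSemidef.one (R := ℂ)).submatrix (QuotientGroup.mk : G → G ⧸ N) using 1
    ext x y
    simp [Set.indicator_apply, Matrix.one_apply, QuotientGroup.eq]

namespace IsNormalizedPosDef

variable {φ : G → ℂ}

theorem map_inv (hφ : IsNormalizedPosDef φ) (x : G) : φ x⁻¹ = star (φ x) := by
  simpa using (hφ.posSemidef.isHermitian.apply x 1).symm

theorem conj (hφ : IsNormalizedPosDef φ) : IsNormalizedPosDef (star φ) where
  map_one := by simp [hφ.map_one]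
  posSemidef := by
    have h : (Matrix.of fun x y => star φ (x⁻¹ * y)) =
        (Matrix.of fun x y => φ (x⁻¹ * y)).transpose := by
      ext x y
      simpa using (hφ.map_inv (x⁻¹ * y)).symm
    exact h ▸ hφ.posSemidef.transpose

theorem exists_unit_vectors (hφ : IsNormalizedPosDef φ) :
    ∃ (H : Type u) (_ : NormedAddCommGroup H) (_ : InnerProductSpace ℂ H) (ξ : G → H),
      (∀ x, ‖ξ x‖ = 1) ∧ ∀ x y, ⟪ξ x, ξ y⟫_ℂ = φ (x⁻¹ * y) := by
  obtain ⟨H, _, _, _, ξ, hξ⟩ := exists_gram_eq hφ.posSemidef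
  have inner_ξ (x y : G) : ⟪ξ x, ξ y⟫_ℂ = φ (x⁻¹ * y) := congr_fun₂ hξ x y
  refine ⟨H, _, _, ξ, fun x => ?_, inner_ξ⟩
  rw [← pow_eq_one_iff_of_nonneg (norm_nonneg _) two_ne_zero, ← Complex.ofReal_inj]
  simpa [hφ.map_one] using (inner_self_eq_norm_sq_to_K (𝕜 := ℂ) (ξ x)).symm.trans (inner_ξ x x)

theorem norm_le_one (hφ : IsNormalizedPosDef φ) (x : G) : ‖φ x‖ ≤ 1 := by
  obtain ⟨H, _, _, ξ, norm_ξ, inner_ξ⟩ := hφ.exists_unit_vectors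
  simpa [inner_ξ, norm_ξ] using norm_inner_le_norm (𝕜 := ℂ) (ξ 1) (ξ x)

theorem map_mul_of_norm_eq_one (hφ : IsNormalizedPosDef φ) {x : G} (hx : ‖φ x‖ = 1) (y : G) :
    φ (y * x) = φ y * φ x := by
  obtain ⟨H, _, _, ξ, norm_ξ, inner_ξ⟩ := hφ.exists_unit_vectors
  have ξ_eq : φ x • ξ 1 = ξ x := by
    refine (inner_eq_one_iff_of_norm_eq_one (𝕜 := ℂ) ?_ (norm_ξ x)).1 ?_
    · rw [norm_smul, hx, norm_ξ, one_mul]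
    · rw [inner_smul_left, inner_ξ, inv_one, one_mul, Complex.conj_mul', hx]
      norm_num
  calc φ (y * x) = ⟪ξ y⁻¹, ξ x⟫_ℂ := by rw [inner_ξ, inv_inv]
    _ = φ y * φ x := by rw [← ξ_eq, inner_smul_right, inner_ξ, inv_inv, mul_one, mul_comm]

/-- The subgroup on which a normalized positive definite function has modulus one. -/
def peripheralSubgroup (hφ : IsNormalizedPosDef φ) : Subgroup G where
  carrier := {x | ‖φ x‖ = 1}
  one_mem' := by simp [hφ.map_one]
  mul_mem' {x y} hx hy := by
    rw [Set.mem_ofPred_eq] at hx hy ⊢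
    rw [hφ.map_mul_of_norm_eq_one hy, norm_mul, hx, hy, one_mul]
  inv_mem' {x} hx := by
    rw [Set.mem_ofPred_eq] at hx ⊢
    rw [hφ.map_inv, norm_star, hx]

theorem star_mul_self_of_mem_peripheralSubgroup (hφ : IsNormalizedPosDef φ) {x : G}
    (hx : x ∈ hφ.peripheralSubgroup) : star (φ x) * φ x = 1 := by
  have norm_eq : ‖φ x‖ = 1 := hx
  simp [Complex.conj_mul', norm_eq]

end IsNormalizedPosDef

end PositiveDefinite

section CompletelyPositive

-- `CStarAlgebra.nonneg_iff_eq_star_mul_self` finds no functional calculus on `CStarMatrix`.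
theorem exists_eq_star_mul_self {D : Type*} [NonUnitalCStarAlgebra D] [PartialOrder D]
    [StarOrderedRing D] {a : D} (ha : 0 ≤ a) : ∃ b, a = star b * b :=
  CStarAlgebra.nonneg_iff_eq_star_mul_self.1 ha

theorem nonneg_of_conjugate_eq_neg {D : Type*} [NonUnitalCStarAlgebra D]
    [PartialOrder D] [StarOrderedRing D] {a : D} (ha : IsSelfAdjoint a)
    (h : ∀ b c : D, star c * a * c = -(star b * b) → b = 0) : 0 ≤ a := by
  have neg_sa : IsSelfAdjoint a⁻ := .of_nonneg (CFC.negPart_nonneg a)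
  have cube_nonneg : 0 ≤ a⁻ * a⁻ * a⁻ := by
    simpa only [neg_sa.star_eq] using star_left_conjugate_nonneg (CFC.negPart_nonneg a) a⁻
  have conjugate_eq : star a⁻ * a * a⁻ = -(a⁻ * a⁻ * a⁻) :=
    calc star a⁻ * a * a⁻ = a⁻ * (a⁺ - a⁻) * a⁻ := by
          rw [neg_sa.star_eq, CFC.posPart_sub_negPart a ha]
      _ = -(a⁻ * a⁻ * a⁻) := by
          rw [mul_sub, sub_mul, CFC.negPart_mul_posPart, zero_mul, zero_sub]
  have cube_eq : a⁻ * a⁻ * a⁻ = 0 := by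
    obtain ⟨b, hb⟩ := exists_eq_star_mul_self cube_nonneg
    rw [hb, h b a⁻ (by rw [conjugate_eq, hb]), mul_zero]
  have neg_eq : a⁻ = 0 := by
    rw [← CStarRing.star_mul_self_eq_zero_iff, ← CStarRing.star_mul_self_eq_zero_iff, star_mul,
      star_star, neg_sa.star_eq, ← mul_assoc, cube_eq, zero_mul]
  rw [← CFC.posPart_sub_negPart a ha, neg_eq, sub_zero]
  exact CFC.posPart_nonneg a

theorem cstarMatrix_nonneg_of_forall_sum_nonneg {A n : Type*} [NonUnitalCStarAlgebra A]
    [PartialOrder A] [StarOrderedRing A] [Fintype n] {M : CStarMatrix n n A}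
    (hM : IsSelfAdjoint M)
    (h : ∀ v : n → A, 0 ≤ ∑ l, (∑ k, star (v k) * M k l) * v l) : 0 ≤ M := by
  refine nonneg_of_conjugate_eq_neg hM fun S C hS => ?_
  have diag_nonpos (i : n) : ∑ k, star (S k i) * S k i ≤ 0 := by
    have form_eq : ∑ l, (∑ k, star (C k i) * M k l) * C l i = (star C * M * C) i i := by
      simp only [CStarMatrix.mul_apply, CStarMatrix.star_apply]
    have := h fun k => C k i
    rw [form_eq, hS, CStarMatrix.neg_apply, CStarMatrix.mul_apply, Left.nonneg_neg_iff] at this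
    simpa only [CStarMatrix.star_apply] using this
  ext k i
  have star_mul_nonneg (k : n) (_ : k ∈ Finset.univ) := star_mul_self_nonneg (S k i)
  exact (CStarRing.star_mul_self_eq_zero_iff _).1 <|
    (Finset.sum_eq_zero_iff_of_nonneg star_mul_nonneg).1
      ((diag_nonpos i).antisymm (Finset.sum_nonneg star_mul_nonneg)) k (Finset.mem_univ k)

variable {A H K n : Type*} [Fintype n] [CStarAlgebra A]
  [NormedAddCommGroup H] [InnerProductSpace ℂ H] [CompleteSpace H]
  [NormedAddCommGroup K] [InnerProductSpace ℂ K] [CompleteSpace K]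

theorem sum_stinespring_nonneg (π : A →⋆ₐ[ℂ] (K →L[ℂ] K)) (V : H →L[ℂ] K) (N : CStarMatrix n n A)
    (v : n → H →L[ℂ] H) :
    0 ≤ ∑ l, (∑ k, star (v k) * (V† ∘L π ((star N * N) k l) ∘L V)) * v l := by
  let W (j : n) : H →L[ℂ] K := ∑ k, π (N j k) ∘L V ∘L v k
  have sum_eq : ∑ l, (∑ k, star (v k) * (V† ∘L π ((star N * N) k l) ∘L V)) * v l =
      ∑ j, (W j)† ∘L W j := by
    have π_apply (k l : n) : π ((star N * N) k l) = ∑ j, (π (N j k))† ∘L π (N j l) := by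
      rw [CStarMatrix.mul_apply]
      refine (map_sum π _ _).trans (Finset.sum_congr rfl fun j _ => ?_)
      rw [CStarMatrix.star_apply, map_mul, map_star]
      rfl
    have W_apply (j : n) : (W j)† ∘L W j =
        ∑ l, ∑ k, star (v k) * (V† ∘L ((π (N j k))† ∘L π (N j l)) ∘L V) * v l := by
      simp only [W, map_sum, ContinuousLinearMap.adjoint_comp, ContinuousLinearMap.comp_finsetSum,
        ContinuousLinearMap.finsetSum_comp]
      rfl
    simp only [π_apply, W_apply, ContinuousLinearMap.comp_finsetSum,
      ContinuousLinearMap.finsetSum_comp, Finset.sum_mul, Finset.mul_sum]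
    exact (Finset.sum_congr rfl fun l _ => Finset.sum_comm).trans Finset.sum_comm
  rw [sum_eq]
  exact Finset.sum_nonneg fun j _ =>
    (ContinuousLinearMap.nonneg_iff_isPositive _).2 (W j).isPositive_adjoint_comp_self

variable {B : StarSubalgebra ℂ (H →L[ℂ] H)}

theorem map_star_of_stinespring {T : A → B} (π : A →⋆ₐ[ℂ] (K →L[ℂ] K)) (V : H →L[ℂ] K)
    (hT : ∀ a, (T a : H →L[ℂ] H) = V† ∘L π a ∘L V) (a : A) : T (star a) = star (T a) := by
  refine Subtype.ext ?_
  simp only [StarMemClass.coe_star, hT, map_star, ContinuousLinearMap.star_eq_adjoint,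
    ContinuousLinearMap.adjoint_comp, ContinuousLinearMap.adjoint_adjoint,
    ContinuousLinearMap.comp_assoc]

/-- A linear map from a C⋆-algebra to a C⋆-algebra of operators which has a Stinespring
representation `a ↦ V⋆ π(a) V` is completely positive. -/
def completelyPositiveOfStinespring [PartialOrder A] [StarOrderedRing A]
    [IsClosed (B : Set (H →L[ℂ] H))] [StarOrderedRing B] (T : A →ₗ[ℂ] B)
    (π : A →⋆ₐ[ℂ] (K →L[ℂ] K)) (V : H →L[ℂ] K)
    (hT : ∀ a, (T a : H →L[ℂ] H) = V† ∘L π a ∘L V) : A →CP B where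
  toLinearMap := T
  map_cstarMatrix_nonneg' n M hM := by
    refine cstarMatrix_nonneg_of_forall_sum_nonneg ?_ fun v => ?_
    · ext k l
      have star_M := CStarMatrix.ext_iff.2 (IsSelfAdjoint.of_nonneg hM).star_eq k l
      rw [CStarMatrix.star_apply] at star_M ⊢
      rw [CStarMatrix.map_apply, CStarMatrix.map_apply, ← map_star_of_stinespring π V hT, star_M]
    · obtain ⟨N, rfl⟩ := exists_eq_star_mul_self hM
      change (0 : H →L[ℂ] H) ≤
        ((∑ l, (∑ k, star (v k) * T ((star N * N) k l)) * v l : B) : H →L[ℂ] H)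
      have := sum_stinespring_nonneg π V N fun k => (v k : H →L[ℂ] H)
      push_cast
      simpa only [hT, StarMemClass.coe_star] using this

end CompletelyPositive

section SchurMultiplier

theorem memlp_two_iff {ι : Type*} {E : ι → Type*} [∀ i, NormedAddCommGroup (E i)]
    {f : ∀ i, E i} : Memℓp f 2 ↔ Summable fun i => ‖f i‖ ^ 2 := by
  rw [memℓp_gen_iff (by norm_num)]
  norm_num

theorem hasSum_norm_sq {ι : Type*} {E : ι → Type*} [∀ i, NormedAddCommGroup (E i)]
    (f : lp E 2) : HasSum (fun i => ‖f i‖ ^ 2) (‖f‖ ^ 2) := by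
  simpa using lp.hasSum_norm (p := 2) (by norm_num) f

/-- The amplification `a ↦ 1 ⊗ a`: the diagonal representation of the bounded operators on `H` on
`ℓ²(ι) ⊗ H`, which is encoded as the Hilbert sum of `ι` copies of `H`. -/
def amplification (ι H : Type*) [NormedAddCommGroup H] [InnerProductSpace ℂ H] [CompleteSpace H] :
    (H →L[ℂ] H) →⋆ₐ[ℂ] (lp (fun _ : ι => H) 2 →L[ℂ] lp (fun _ : ι => H) 2) where
  toFun a := lp.mapCLM 2 (fun _ => a) (norm_nonneg a) fun _ => le_rfl
  map_one' := rfl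
  map_mul' _ _ := rfl
  map_zero' := rfl
  map_add' _ _ := rfl
  commutes' _ := rfl
  map_star' a := by
    rw [ContinuousLinearMap.star_eq_adjoint, ContinuousLinearMap.star_eq_adjoint,
      ContinuousLinearMap.eq_adjoint_iff]
    intro f g
    rw [lp.inner_eq_tsum, lp.inner_eq_tsum]
    exact tsum_congr fun i => ContinuousLinearMap.adjoint_inner_left a _ _

variable {X ι : Type*} {v : ι → X → ℂ}

theorem hasSum_norm_mul_sq_prod (hv : ∀ y, HasSum (fun i => ‖v i y‖ ^ 2) 1) (f : ℓ²(X, ℂ)) :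
    HasSum (fun p : ι × X => ‖v p.1 p.2 * f p.2‖ ^ 2) (‖f‖ ^ 2) := by
  have fiber (y : X) : HasSum (fun i => ‖v i y * f y‖ ^ 2) (‖f y‖ ^ 2) := by
    simpa [mul_pow] using (hv y).mul_right (‖f y‖ ^ 2)
  have summable : Summable fun p : X × ι => ‖v p.2 p.1 * f p.1‖ ^ 2 := by
    refine (summable_prod_of_nonneg fun p => by positivity).2 ⟨fun y => (fiber y).summable, ?_⟩
    simpa only [(fiber _).tsum_eq] using (hasSum_norm_sq f).summable
  have hasSum_prod : HasSum (fun p : X × ι => ‖v p.2 p.1 * f p.1‖ ^ 2) (‖f‖ ^ 2) := by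
    rw [← (summable.hasSum.prod_fiberwise fiber).unique (hasSum_norm_sq f)]
    exact summable.hasSum
  have hasSum_swap := (Equiv.prodComm ι X).hasSum_iff.2 hasSum_prod
  exact hasSum_swap

/-- For a family of functions `v i` with `∑ |v i|² = 1`, the isometry from `ℓ²` to the Hilbert sum
of copies of `ℓ²` whose components are the multiplication operators by the `v i`. -/
def multiplicationIsometry (hv : ∀ y, HasSum (fun i => ‖v i y‖ ^ 2) 1) :
    ℓ²(X, ℂ) →ₗᵢ[ℂ] lp (fun _ : ι => ℓ²(X, ℂ)) 2 :=
  let component (f : ℓ²(X, ℂ)) (i : ι) : ℓ²(X, ℂ) :=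
    ⟨fun y => v i y * f y, memlp_two_iff.2 ((hasSum_norm_mul_sq_prod hv f).summable.prod_factor i)⟩
  have hasSum_component (f : ℓ²(X, ℂ)) : HasSum (fun i => ‖component f i‖ ^ 2) (‖f‖ ^ 2) :=
    (hasSum_norm_mul_sq_prod hv f).prod_fiberwise fun i => hasSum_norm_sq (component f i)
  { toFun f := ⟨component f, memlp_two_iff.2 (hasSum_component f).summable⟩
    map_add' f g := by ext i y; exact mul_add _ _ _
    map_smul' c f := by ext i y; exact mul_left_comm _ _ _
    norm_map' f := by
      rw [← sq_eq_sq₀ (norm_nonneg _) (norm_nonneg _)]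
      exact (hasSum_norm_sq _).unique (hasSum_component f) }

theorem multiplicationIsometry_apply (hv : ∀ y, HasSum (fun i => ‖v i y‖ ^ 2) 1) (f : ℓ²(X, ℂ))
    (i : ι) (y : X) : (multiplicationIsometry hv f i : X → ℂ) y = v i y * f y := rfl

theorem multiplicationIsometry_single [DecidableEq X]
    (hv : ∀ y, HasSum (fun i => ‖v i y‖ ^ 2) 1) (y : X) (i : ι) :
    multiplicationIsometry hv (lp.single 2 y (1 : ℂ)) i = lp.single 2 y (v i y) := by
  ext z
  rw [multiplicationIsometry_apply, lp.single_apply, lp.single_apply]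
  by_cases hz : z = y
  · subst hz; simp
  · simp [hz]

/-- The Schur multiplier `a ↦ ∑ᵢ vᵢ⋆ a vᵢ` defined by the multiplication operators by a family of
functions `vᵢ` with `∑ |vᵢ|² = 1`. -/
def schurMultiplier (hv : ∀ y, HasSum (fun i => ‖v i y‖ ^ 2) 1) :
    (ℓ²(X, ℂ) →L[ℂ] ℓ²(X, ℂ)) →ₗ[ℂ] (ℓ²(X, ℂ) →L[ℂ] ℓ²(X, ℂ)) where
  toFun a := (multiplicationIsometry hv).toContinuousLinearMap† ∘L
    amplification ι ℓ²(X, ℂ) a ∘L (multiplicationIsometry hv).toContinuousLinearMap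
  map_add' a b := by rw [map_add, ContinuousLinearMap.add_comp, ContinuousLinearMap.comp_add]
  map_smul' c a := by
    rw [map_smul, ContinuousLinearMap.smul_comp, ContinuousLinearMap.comp_smul, RingHom.id_apply]

theorem norm_schurMultiplier_le (hv : ∀ y, HasSum (fun i => ‖v i y‖ ^ 2) 1)
    (a : ℓ²(X, ℂ) →L[ℂ] ℓ²(X, ℂ)) : ‖schurMultiplier hv a‖ ≤ ‖a‖ := by
  let V := (multiplicationIsometry hv).toContinuousLinearMap
  have norm_V : ‖V‖ ≤ 1 := LinearIsometry.norm_toContinuousLinearMap_le _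
  have norm_V_adjoint : ‖V†‖ ≤ 1 := (LinearIsometryEquiv.norm_map _ V).trans_le norm_V
  calc ‖V† ∘L amplification ι ℓ²(X, ℂ) a ∘L V‖
      ≤ ‖V†‖ * (‖amplification ι ℓ²(X, ℂ) a‖ * ‖V‖) :=
        (ContinuousLinearMap.opNorm_comp_le _ _).trans <| by
          gcongr; exact ContinuousLinearMap.opNorm_comp_le _ _
    _ ≤ 1 * (‖a‖ * 1) := by
        gcongr; exact NonUnitalStarAlgHom.norm_apply_le (amplification ι ℓ²(X, ℂ)) a
    _ = ‖a‖ := by rw [one_mul, mul_one]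

theorem hasSum_schurMultiplier_apply (hv : ∀ y, HasSum (fun i => ‖v i y‖ ^ 2) 1)
    (a : ℓ²(X, ℂ) →L[ℂ] ℓ²(X, ℂ)) (f : ℓ²(X, ℂ)) (y : X) :
    HasSum (fun i => star (v i y) * (a (multiplicationIsometry hv f i) : X → ℂ) y)
      ((schurMultiplier hv a f : X → ℂ) y) := by
  classical
  let V := (multiplicationIsometry hv).toContinuousLinearMap
  let δ : ℓ²(X, ℂ) := lp.single 2 y 1
  have inner_δ (g : ℓ²(X, ℂ)) : ⟪δ, g⟫_ℂ = g y := by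
    rw [lp.inner_single_left, RCLike.inner_apply', map_one, one_mul]
  have inner_V_δ (g : ℓ²(X, ℂ)) (i : ι) : ⟪V δ i, g⟫_ℂ = star (v i y) * g y := by
    rw [show V δ i = lp.single 2 y (v i y) from multiplicationIsometry_single hv y i,
      lp.inner_single_left, RCLike.inner_apply', Complex.star_def]
  have hasSum_inner := lp.hasSum_inner (𝕜 := ℂ) (V δ) (amplification ι ℓ²(X, ℂ) a (V f))
  rw [← ContinuousLinearMap.adjoint_inner_right, inner_δ] at hasSum_inner
  simp only [inner_V_δ] at hasSum_inner
  exact hasSum_inner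

end SchurMultiplier

section ReducedAlgebra

variable {G : Type*} [Group G]

theorem schurMultiplier_regularRep {ι : Type*} {v : ι → G → ℂ} {φ : G → ℂ}
    (hv : ∀ y, HasSum (fun i => ‖v i y‖ ^ 2) 1)
    (hφ : ∀ x y, HasSum (fun i => star (v i y) * v i (x⁻¹ * y)) (φ x)) (x : G) :
    schurMultiplier hv (regularRep G x) = φ x • regularRep G x := by
  ext f y
  refine (hasSum_schurMultiplier_apply hv (regularRep G x) f y).unique ?_
  refine ((hφ x y).mul_right ((f : G → ℂ) (x⁻¹ * y))).congr_fun fun i => ?_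
  exact (mul_assoc (star (v i y)) (v i (x⁻¹ * y)) _).symm

theorem U_one : U (1 : G) = 1 := Subtype.ext (map_one (regularRep G))

theorem U_mul (x y : G) : U (x * y) = U x * U y := Subtype.ext (map_mul (regularRep G) x y)

theorem star_regularRep (x : G) : star (regularRep G x) = regularRep G x⁻¹ := by
  rw [ContinuousLinearMap.star_eq_adjoint, eq_comm, ContinuousLinearMap.eq_adjoint_iff]
  intro f g
  have g_eq : g = regularRep G x⁻¹ (regularRep G x g) := by
    rw [← mul_apply_eq_comp, ← map_mul, inv_mul_cancel, map_one]
    rfl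
  conv_lhs => rw [g_eq]
  exact (translate x⁻¹).inner_map_map _ _

theorem star_U (x : G) : star (U x) = U x⁻¹ := Subtype.ext (star_regularRep x)

theorem adjoin_image_subgroup {R A : Type*} [CommSemiring R] [StarRing R] [Semiring A] [StarRing A]
    [Algebra R A] [StarModule R A]
    (u : G →* A) (hu : ∀ x, star (u x) = u x⁻¹) (N : Subgroup G) :
    Subalgebra.toSubmodule (StarAlgebra.adjoin R (u '' (N : Set G))).toSubalgebra =
      Submodule.span R (u '' (N : Set G)) := by
  have star_subset : star (u '' (N : Set G)) ⊆ u '' (N : Set G) := by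
    rintro a ⟨x, hx, h⟩
    exact ⟨x⁻¹, N.inv_mem hx, by rw [← hu, h, star_star]⟩
  rw [StarAlgebra.adjoin_eq_span, Set.union_eq_self_of_subset_right star_subset]
  exact congrArg (fun S : Submonoid A => Submodule.span R (S : Set A))
    (Submonoid.closure_eq (N.toSubmonoid.map u))

theorem coe_reducedCStarAlgebra :
    (reducedCStarAlgebra G : Set (ℓ²(G, ℂ) →L[ℂ] ℓ²(G, ℂ))) =
      closure (Submodule.span ℂ (Set.range (regularRep G))) := by
  have adjoin_eq := adjoin_image_subgroup (R := ℂ) (regularRep G) star_regularRep ⊤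
  rw [Subgroup.coe_top, Set.image_univ] at adjoin_eq
  exact congrArg closure (congrArg SetLike.coe adjoin_eq)

theorem dense_span_range_U :
    Dense (Submodule.span ℂ (Set.range (U (G := G))) : Set (reducedCStarAlgebra G)) := by
  intro a
  have val_image : Subtype.val '' (Submodule.span ℂ (Set.range (U (G := G))) :
      Set (reducedCStarAlgebra G)) = Submodule.span ℂ (Set.range (regularRep G)) := by
    refine (Submodule.map_coe (reducedCStarAlgebra G).subtype.toAlgHom.toLinearMap _).symm.trans ?_
    rw [Submodule.map_span, ← Set.range_comp]
    rfl
  rw [closure_subtype, val_image, ← coe_reducedCStarAlgebra]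
  exact a.2

/-- The norm closure of the span of the `U x` with `x ∈ N`, a copy of the reduced C⋆-algebra of the
subgroup `N`. -/
def subgroupAlgebra (N : Subgroup G) : StarSubalgebra ℂ (reducedCStarAlgebra G) :=
  (StarAlgebra.adjoin ℂ (U '' (N : Set G))).topologicalClosure

theorem isClosed_subgroupAlgebra (N : Subgroup G) :
    IsClosed (subgroupAlgebra N : Set (reducedCStarAlgebra G)) :=
  StarSubalgebra.isClosed_topologicalClosure _

theorem U_mem_subgroupAlgebra {N : Subgroup G} {x : G} (hx : x ∈ N) : U x ∈ subgroupAlgebra N :=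
  StarSubalgebra.le_topologicalClosure _ (StarAlgebra.subset_adjoin ℂ _ ⟨x, hx, rfl⟩)

theorem coe_subgroupAlgebra (N : Subgroup G) :
    (subgroupAlgebra N : Set (reducedCStarAlgebra G)) =
      closure (Submodule.span ℂ (U '' (N : Set G))) := by
  let u : G →* reducedCStarAlgebra G := { toFun := U, map_one' := U_one, map_mul' := U_mul }
  exact congrArg closure (congrArg SetLike.coe (adjoin_image_subgroup (R := ℂ) u star_U N))

theorem isNormalizedPosDef_state {ρ : reducedCStarAlgebra G →ₚ[ℂ] ℂ} (hρ : ρ 1 = 1) :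
    IsNormalizedPosDef fun x => ρ (U x) where
  map_one := by rw [U_one, hρ]
  posSemidef := by simpa only [star_U, U_mul] using posSemidef_map_star_mul ρ U

end ReducedAlgebra

section DenseSpan

variable {R X Y : Type*} [Semiring R] [AddCommMonoid X] [Module R X] [TopologicalSpace X]
  [AddCommMonoid Y] [Module R Y] [TopologicalSpace Y]

theorem map_mem_of_mem_closure_span {f : X →ₗ[R] Y} (hf : Continuous f) {s : Set X}
    {W : Submodule R Y} (hW : IsClosed (W : Set Y)) (h : ∀ x ∈ s, f x ∈ W) {x : X}
    (hx : x ∈ closure (Submodule.span R s : Set X)) : f x ∈ W :=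
  closure_minimal (Submodule.span_le.2 h : Submodule.span R s ≤ W.comap f) (hW.preimage hf) hx

end DenseSpan

section Contractions

variable {𝕜 X : Type*} [NormedField 𝕜] [NormedAddCommGroup X] [NormedSpace 𝕜 X]

theorem norm_pow_apply_le {T : X →ₗ[𝕜] X} (hT : ∀ x, ‖T x‖ ≤ ‖x‖) (n : ℕ) (x : X) :
    ‖(T ^ n) x‖ ≤ ‖x‖ := by
  induction n with
  | zero => simp
  | succ n ih => rw [pow_succ', Module.End.mul_apply]; exact (hT _).trans ih

theorem pow_apply_of_eq_smul {T : X →ₗ[𝕜] X} {x : X} {c : 𝕜} (hx : T x = c • x) (n : ℕ) :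
    (T ^ n) x = c ^ n • x := by
  induction n with
  | zero => simp
  | succ n ih => rw [pow_succ', Module.End.mul_apply, ih, map_smul, hx, smul_smul, pow_succ]

/-- The subspace of the vectors with totally bounded orbit under a linear map `T`. -/
def totallyBoundedOrbit (T : X →ₗ[𝕜] X) : Submodule 𝕜 X where
  carrier := {x | TotallyBounded (Set.range fun n : ℕ => (T ^ n) x)}
  zero_mem' := by
    refine (Set.finite_singleton (0 : X)).totallyBounded.subset ?_
    rintro _ ⟨n, rfl⟩
    simp
  add_mem' {x y} hx hy := by
    refine Metric.totallyBounded_iff.2 fun ε hε => ?_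
    obtain ⟨t, ht, hxt⟩ := Metric.totallyBounded_iff.1 hx (ε / 2) (by positivity)
    obtain ⟨u, hu, hyu⟩ := Metric.totallyBounded_iff.1 hy (ε / 2) (by positivity)
    refine ⟨Set.image2 (· + ·) t u, ht.image2 _ hu, ?_⟩
    rintro _ ⟨n, rfl⟩
    obtain ⟨z, hz, hxz⟩ := Set.mem_iUnion₂.1 (hxt ⟨n, rfl⟩)
    obtain ⟨w, hw, hyw⟩ := Set.mem_iUnion₂.1 (hyu ⟨n, rfl⟩)
    refine Set.mem_iUnion₂.2 ⟨z + w, Set.mem_image2_of_mem hz hw, ?_⟩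
    calc dist ((T ^ n) (x + y)) (z + w)
        ≤ dist ((T ^ n) x) z + dist ((T ^ n) y) w := by rw [map_add]; exact dist_add_add_le _ _ _ _
      _ < ε / 2 + ε / 2 := add_lt_add hxz hyw
      _ = ε := add_halves ε
  smul_mem' c x hx := by
    refine (hx.image (uniformContinuous_const_smul c)).subset ?_
    rintro _ ⟨n, rfl⟩
    exact ⟨(T ^ n) x, ⟨n, rfl⟩, (map_smul _ _ _).symm⟩

theorem isClosed_totallyBoundedOrbit {T : X →ₗ[𝕜] X} (hT : ∀ x, ‖T x‖ ≤ ‖x‖) :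
    IsClosed (totallyBoundedOrbit T : Set X) := by
  refine isClosed_of_closure_subset fun x hx => Metric.totallyBounded_iff.2 fun ε hε => ?_
  obtain ⟨y, hy, hxy⟩ := Metric.mem_closure_iff.1 hx (ε / 2) (by positivity)
  obtain ⟨t, ht, hyt⟩ := Metric.totallyBounded_iff.1 hy (ε / 2) (by positivity)
  refine ⟨t, ht, ?_⟩
  rintro _ ⟨n, rfl⟩
  obtain ⟨z, hz, hyz⟩ := Set.mem_iUnion₂.1 (hyt ⟨n, rfl⟩)
  refine Set.mem_iUnion₂.2 ⟨z, hz, ?_⟩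
  have dist_pow_le : dist ((T ^ n) x) ((T ^ n) y) ≤ dist x y := by
    rw [dist_eq_norm, dist_eq_norm, ← map_sub]
    exact norm_pow_apply_le hT n _
  rw [Metric.mem_ball] at hyz ⊢
  linarith [dist_triangle ((T ^ n) x) ((T ^ n) y) z]

theorem mem_totallyBoundedOrbit_of_eq_smul [ProperSpace 𝕜] {T : X →ₗ[𝕜] X} {x : X} {c : 𝕜}
    (hc : ‖c‖ ≤ 1) (hx : T x = c • x) : x ∈ totallyBoundedOrbit T := by
  have isCompact_image : IsCompact ((fun z : 𝕜 => z • x) '' Metric.closedBall 0 1) :=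
    (isCompact_closedBall 0 1).image (by fun_prop)
  refine isCompact_image.totallyBounded.subset ?_
  rintro _ ⟨n, rfl⟩
  refine ⟨c ^ n, ?_, (pow_apply_of_eq_smul hx n).symm⟩
  rw [mem_closedBall_zero_iff, norm_pow]
  exact pow_le_one₀ (norm_nonneg _) hc

theorem isLocallyFiniteContraction_of_dense {X : Type*} [NormedAddCommGroup X] [NormedSpace ℂ X]
    [CompleteSpace X] {T : X →ₗ[ℂ] X} (hT : ∀ x, ‖T x‖ ≤ ‖x‖) {s : Set X}
    (hs : Dense (Submodule.span ℂ s : Set X)) (h : ∀ x ∈ s, ∃ c : ℂ, ‖c‖ ≤ 1 ∧ T x = c • x) :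
    IsLocallyFiniteContraction T := by
  refine ⟨hT, fun x => ?_⟩
  have totallyBounded_orbit : x ∈ totallyBoundedOrbit T :=
    map_mem_of_mem_closure_span (f := LinearMap.id) continuous_id (isClosed_totallyBoundedOrbit hT)
      (fun y hy => let ⟨_, hc, hTy⟩ := h y hy; mem_totallyBoundedOrbit_of_eq_smul hc hTy) (hs x)
  exact (TotallyBounded.closure totallyBounded_orbit).isCompact_of_isClosed isClosed_closure

theorem tendsto_zero_of_dense {R : ℕ → X →ₗ[𝕜] X} {C : ℝ} (hR : ∀ n x, ‖R n x‖ ≤ C * ‖x‖)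
    {s : Set X} (hs : Dense (Submodule.span 𝕜 s : Set X))
    (h : ∀ x ∈ s, Tendsto (fun n => R n x) atTop (𝓝 0)) (x : X) :
    Tendsto (fun n => R n x) atTop (𝓝 0) := by
  let W : Submodule 𝕜 X :=
    { carrier := {x | Tendsto (fun n => R n x) atTop (𝓝 0)}
      zero_mem' := by simp
      add_mem' := fun {x y} hx hy => by simpa using! Tendsto.add hx hy
      smul_mem' := fun c x hx => by simpa using! Tendsto.const_smul hx c }
  have isClosed_W : IsClosed (W : Set X) := by
    refine Equicontinuous.isClosed_setOfPred_tendsto (f := 0) ?_ continuous_const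
    exact (LipschitzWith.uniformEquicontinuous _ _ fun n =>
      AddMonoidHomClass.lipschitz_of_bound (R n) C (hR n)).equicontinuous
  exact map_mem_of_mem_closure_span (f := LinearMap.id) continuous_id isClosed_W h (hs x)

theorem tendsto_norm_iterate_sub {T E : X →ₗ[𝕜] X} (hT : ∀ x, ‖T x‖ ≤ ‖x‖)
    (hE : ∀ x, ‖E x‖ ≤ ‖x‖) {s : Set X} (hs : Dense (Submodule.span 𝕜 s : Set X))
    (h : ∀ x ∈ s, E x = x ∨ E x = 0 ∧ ∃ c : 𝕜, ‖c‖ < 1 ∧ T x = c • x) (x : X) :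
    Tendsto (fun n => ‖T^[n] x - T^[n] (E x)‖) atTop (𝓝 0) := by
  let R (n : ℕ) : X →ₗ[𝕜] X := (T ^ n) ∘ₗ (LinearMap.id - E)
  have norm_R_le (n : ℕ) (x : X) : ‖R n x‖ ≤ 2 * ‖x‖ :=
    calc ‖R n x‖ ≤ ‖x - E x‖ := norm_pow_apply_le hT n _
      _ ≤ ‖x‖ + ‖E x‖ := norm_sub_le _ _
      _ ≤ 2 * ‖x‖ := by linarith [hE x]
  have tendsto_R : Tendsto (fun n => R n x) atTop (𝓝 0) := by
    refine tendsto_zero_of_dense norm_R_le hs (fun y hy => ?_) x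
    change Tendsto (fun n => (T ^ n) (y - E y)) atTop (𝓝 0)
    rcases h y hy with hfix | ⟨hker, c, hc, hTy⟩
    · simp [hfix]
    · simp only [hker, sub_zero, pow_apply_of_eq_smul hTy]
      simpa using (tendsto_pow_atTop_nhds_zero_of_norm_lt_one hc).smul_const y
  refine (tendsto_norm_zero.comp tendsto_R).congr fun n => ?_
  rw [← Module.End.pow_apply, ← Module.End.pow_apply, ← map_sub]
  rfl

end Contractions

section Multiplier

variable {G : Type u} [Group G]

theorem completelyPositiveMap_ext {S T : reducedCStarAlgebra G →CP reducedCStarAlgebra G}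
    (h : ∀ x, S (U x) = T (U x)) : S = T :=
  DFunLike.coe_injective <| Continuous.ext_on dense_span_range_U (map_continuous S)
    (map_continuous T) <| LinearMap.eqOn_span (f := S.toLinearMap) (g := T.toLinearMap) <|
      Set.forall_mem_range.2 h

theorem schurMultiplier_mem {ι : Type*} {v : ι → G → ℂ} {φ : G → ℂ}
    (hv : ∀ y, HasSum (fun i => ‖v i y‖ ^ 2) 1)
    (hφ : ∀ x y, HasSum (fun i => star (v i y) * v i (x⁻¹ * y)) (φ x))
    {a : ℓ²(G, ℂ) →L[ℂ] ℓ²(G, ℂ)} (ha : a ∈ reducedCStarAlgebra G) :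
    schurMultiplier hv a ∈ reducedCStarAlgebra G := by
  have continuous_schurMultiplier : Continuous (schurMultiplier hv) :=
    AddMonoidHomClass.continuous_of_bound _ 1 (by simpa using norm_schurMultiplier_le hv)
  rw [← SetLike.mem_coe, coe_reducedCStarAlgebra] at ha
  refine map_mem_of_mem_closure_span
    (W := Subalgebra.toSubmodule (reducedCStarAlgebra G).toSubalgebra) continuous_schurMultiplier
    (isClosed_reducedCStarAlgebra G) (Set.forall_mem_range.2 fun x => ?_) ha
  rw [schurMultiplier_regularRep hv hφ]
  exact (φ x • U x).2

theorem exists_completelyPositive_of_hasSum {ι : Type*} {v : ι → G → ℂ} {φ : G → ℂ}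
    (hv : ∀ y, HasSum (fun i => ‖v i y‖ ^ 2) 1)
    (hφ : ∀ x y, HasSum (fun i => star (v i y) * v i (x⁻¹ * y)) (φ x)) :
    ∃ P : reducedCStarAlgebra G →CP reducedCStarAlgebra G,
      (∀ x, P (U x) = φ x • U x) ∧ ∀ a, ‖P a‖ ≤ ‖a‖ := by
  let T : reducedCStarAlgebra G →ₗ[ℂ] reducedCStarAlgebra G :=
    { toFun a := ⟨schurMultiplier hv a, schurMultiplier_mem hv hφ a.2⟩
      map_add' a b := Subtype.ext (map_add (schurMultiplier hv) _ _)
      map_smul' c a := Subtype.ext (map_smul (schurMultiplier hv) _ _) }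
  exact ⟨completelyPositiveOfStinespring T
    ((amplification ι ℓ²(G, ℂ)).comp (reducedCStarAlgebra G).subtype)
    (multiplicationIsometry hv).toContinuousLinearMap fun _ => rfl,
    fun x => Subtype.ext (schurMultiplier_regularRep hv hφ x),
    fun a => norm_schurMultiplier_le hv a⟩

namespace IsNormalizedPosDef

variable {φ : G → ℂ}

theorem exists_hasSum_star_mul (hφ : IsNormalizedPosDef φ) :
    ∃ (ι : Type u) (v : ι → G → ℂ), (∀ y, HasSum (fun i => ‖v i y‖ ^ 2) 1) ∧
      ∀ x y, HasSum (fun i => star (v i y) * v i (x⁻¹ * y)) (φ x) := by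
  obtain ⟨ι, w, hw⟩ := ReducedGroup.exists_hasSum_star_mul hφ.posSemidef
  have hasSum_inv (x y : G) : HasSum (fun i => star (w i y⁻¹) * w i (x⁻¹ * y)⁻¹) (φ x) := by
    simpa using hw y⁻¹ (x⁻¹ * y)⁻¹
  refine ⟨ι, fun i y => w i y⁻¹, fun y => ?_, hasSum_inv⟩
  rw [← Complex.hasSum_ofReal]
  simpa [hφ.map_one, Complex.conj_mul'] using hasSum_inv 1 y

theorem exists_completelyPositive (hφ : IsNormalizedPosDef φ) :
    ∃ P : reducedCStarAlgebra G →CP reducedCStarAlgebra G,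
      (∀ x, P (U x) = φ x • U x) ∧ ∀ a, ‖P a‖ ≤ ‖a‖ := by
  obtain ⟨ι, v, hv, hvφ⟩ := hφ.exists_hasSum_star_mul
  exact exists_completelyPositive_of_hasSum hv hvφ

/-- The multiplier `U x ↦ φ x • U x` of the reduced C⋆-algebra with symbol a normalized positive
definite function `φ`. -/
def multiplier (hφ : IsNormalizedPosDef φ) : reducedCStarAlgebra G →CP reducedCStarAlgebra G :=
  hφ.exists_completelyPositive.choose

theorem multiplier_U (hφ : IsNormalizedPosDef φ) (x : G) : hφ.multiplier (U x) = φ x • U x :=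
  hφ.exists_completelyPositive.choose_spec.1 x

theorem norm_multiplier_le (hφ : IsNormalizedPosDef φ) (a : reducedCStarAlgebra G) :
    ‖hφ.multiplier a‖ ≤ ‖a‖ :=
  hφ.exists_completelyPositive.choose_spec.2 a

theorem multiplier_mem_subgroupAlgebra (hφ : IsNormalizedPosDef φ) {N : Subgroup G}
    {b : reducedCStarAlgebra G} (hb : b ∈ subgroupAlgebra N) :
    hφ.multiplier b ∈ subgroupAlgebra N := by
  rw [← SetLike.mem_coe, coe_subgroupAlgebra] at hb
  refine map_mem_of_mem_closure_span (f := hφ.multiplier.toLinearMap)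
    (W := Subalgebra.toSubmodule (subgroupAlgebra N).toSubalgebra) (map_continuous hφ.multiplier)
    (isClosed_subgroupAlgebra N) (Set.forall_mem_image.2 fun x hx => ?_) hb
  change hφ.multiplier (U x) ∈ subgroupAlgebra N
  rw [hφ.multiplier_U]
  exact SMulMemClass.smul_mem _ (U_mem_subgroupAlgebra hx)

theorem multiplier_mul (hφ : IsNormalizedPosDef φ) (a : reducedCStarAlgebra G)
    {b : reducedCStarAlgebra G} (hb : b ∈ subgroupAlgebra hφ.peripheralSubgroup) :
    hφ.multiplier (a * b) = hφ.multiplier a * hφ.multiplier b := by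
  set P := hφ.multiplier
  have continuous_P : Continuous P := map_continuous P
  have mul_U (x : G) (hx : ‖φ x‖ = 1) : P (a * U x) = P a * P (U x) := by
    refine congr_fun (Continuous.ext_on dense_span_range_U (f := fun a => P (a * U x))
      (g := fun a => P a * P (U x)) (by fun_prop) (by fun_prop) ?_) a
    refine LinearMap.eqOn_span (f := P.toLinearMap ∘ₗ LinearMap.mulRight ℂ (U x))
      (g := LinearMap.mulRight ℂ (P (U x)) ∘ₗ P.toLinearMap) (Set.forall_mem_range.2 fun y => ?_)
    change P (U y * U x) = P (U y) * P (U x)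
    rw [← U_mul, hφ.multiplier_U, hφ.multiplier_U, hφ.multiplier_U,
      hφ.map_mul_of_norm_eq_one hx, smul_mul_smul_comm, U_mul]
  rw [← SetLike.mem_coe, coe_subgroupAlgebra] at hb
  refine Set.EqOn.closure (f := fun b => P (a * b)) (g := fun b => P a * P b) ?_
    (by fun_prop) (by fun_prop) hb
  exact LinearMap.eqOn_span (f := P.toLinearMap ∘ₗ LinearMap.mulLeft ℂ a)
    (g := LinearMap.mulLeft ℂ (P a) ∘ₗ P.toLinearMap) (Set.forall_mem_image.2 mul_U)

theorem multiplier_multiplier_eq_self {ψ : G → ℂ} (hφ : IsNormalizedPosDef φ)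
    (hψ : IsNormalizedPosDef ψ) {N : Subgroup G} (h : ∀ x ∈ N, φ x * ψ x = 1)
    {b : reducedCStarAlgebra G} (hb : b ∈ subgroupAlgebra N) :
    hφ.multiplier (hψ.multiplier b) = b := by
  rw [← SetLike.mem_coe, coe_subgroupAlgebra] at hb
  refine Set.EqOn.closure (f := hφ.multiplier ∘ hψ.multiplier) (g := id) ?_
    ((map_continuous hφ.multiplier).comp (map_continuous hψ.multiplier)) continuous_id hb
  refine LinearMap.eqOn_span (f := hφ.multiplier.toLinearMap ∘ₗ hψ.multiplier.toLinearMap)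
    (g := LinearMap.id) (Set.forall_mem_image.2 fun x hx => ?_)
  change hφ.multiplier (hψ.multiplier (U x)) = U x
  rw [hψ.multiplier_U, map_smul, hφ.multiplier_U, smul_smul, mul_comm, h x hx, one_smul]

/-- The restriction of the multiplier by `φ` to the algebra of the subgroup on which `φ` has modulus
one; its inverse is the restriction of the multiplier by the conjugate of `φ`. -/
def peripheralAut (hφ : IsNormalizedPosDef φ) :
    subgroupAlgebra hφ.peripheralSubgroup ≃⋆ₐ[ℂ] subgroupAlgebra hφ.peripheralSubgroup where
  toFun b := ⟨hφ.multiplier b, hφ.multiplier_mem_subgroupAlgebra b.2⟩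
  invFun b := ⟨hφ.conj.multiplier b, hφ.conj.multiplier_mem_subgroupAlgebra b.2⟩
  left_inv b := Subtype.ext <| hφ.conj.multiplier_multiplier_eq_self hφ
    (fun _ hx => hφ.star_mul_self_of_mem_peripheralSubgroup hx) b.2
  right_inv b := Subtype.ext <| hφ.multiplier_multiplier_eq_self hφ.conj
    (fun _ hx => (mul_comm _ _).trans (hφ.star_mul_self_of_mem_peripheralSubgroup hx)) b.2
  map_mul' _ b := Subtype.ext <| hφ.multiplier_mul _ b.2
  map_add' _ _ := Subtype.ext <| map_add hφ.multiplier _ _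
  map_star' _ := Subtype.ext <| map_star hφ.multiplier _
  map_smul' _ _ := Subtype.ext <| map_smul hφ.multiplier _ _

theorem coe_peripheralAut_pow (hφ : IsNormalizedPosDef φ) (n : ℕ)
    (b : subgroupAlgebra hφ.peripheralSubgroup) :
    ((hφ.peripheralAut ^ n) b : reducedCStarAlgebra G) = hφ.multiplier^[n] b := by
  have semiconj : Function.Semiconj Subtype.val hφ.peripheralAut hφ.multiplier := fun _ => rfl
  rw [StarAlgEquiv.coe_pow]
  exact semiconj.iterate_right n b

end IsNormalizedPosDef

/-- The conditional expectation of the reduced C⋆-algebra onto the algebra of a subgroup. -/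
def subgroupExpectation (N : Subgroup G) : reducedCStarAlgebra G →CP reducedCStarAlgebra G :=
  (isNormalizedPosDef_indicator N).multiplier

theorem subgroupExpectation_U_of_mem {N : Subgroup G} {x : G} (hx : x ∈ N) :
    subgroupExpectation N (U x) = U x := by
  rw [subgroupExpectation, IsNormalizedPosDef.multiplier_U, Set.indicator_of_mem hx,
    Pi.one_apply, one_smul]

theorem subgroupExpectation_U_of_notMem {N : Subgroup G} {x : G} (hx : x ∉ N) :
    subgroupExpectation N (U x) = 0 := by
  rw [subgroupExpectation, IsNormalizedPosDef.multiplier_U, Set.indicator_of_notMem hx, zero_smul]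

theorem norm_subgroupExpectation_le (N : Subgroup G) (a : reducedCStarAlgebra G) :
    ‖subgroupExpectation N a‖ ≤ ‖a‖ :=
  IsNormalizedPosDef.norm_multiplier_le _ a

theorem subgroupExpectation_mem (N : Subgroup G) (a : reducedCStarAlgebra G) :
    subgroupExpectation N a ∈ subgroupAlgebra N := by
  refine map_mem_of_mem_closure_span (f := (subgroupExpectation N).toLinearMap)
    (W := Subalgebra.toSubmodule (subgroupAlgebra N).toSubalgebra)
    (map_continuous (subgroupExpectation N)) (isClosed_subgroupAlgebra N)
    (Set.forall_mem_range.2 fun x => ?_) (dense_span_range_U a)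
  change subgroupExpectation N (U x) ∈ subgroupAlgebra N
  by_cases hx : x ∈ N
  · rw [subgroupExpectation_U_of_mem hx]
    exact U_mem_subgroupAlgebra hx
  · rw [subgroupExpectation_U_of_notMem hx]
    exact zero_mem _

theorem subgroupExpectation_eq_self {N : Subgroup G} {b : reducedCStarAlgebra G}
    (hb : b ∈ subgroupAlgebra N) : subgroupExpectation N b = b := by
  rw [← SetLike.mem_coe, coe_subgroupAlgebra] at hb
  refine Set.EqOn.closure (g := id) ?_ (map_continuous (subgroupExpectation N)) continuous_id hb
  exact LinearMap.eqOn_span (f := (subgroupExpectation N).toLinearMap) (g := LinearMap.id)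
    (Set.forall_mem_image.2 fun x hx => subgroupExpectation_U_of_mem hx)

theorem range_subgroupExpectation (N : Subgroup G) :
    Set.range (subgroupExpectation N) = (subgroupAlgebra N : Set (reducedCStarAlgebra G)) :=
  (Set.range_subset_iff.2 (subgroupExpectation_mem N)).antisymm fun b hb =>
    ⟨b, subgroupExpectation_eq_self hb⟩

namespace IsNormalizedPosDef

variable {φ : G → ℂ}

theorem isLocallyFiniteContraction_multiplier (hφ : IsNormalizedPosDef φ) :
    IsLocallyFiniteContraction hφ.multiplier.toLinearMap :=
  isLocallyFiniteContraction_of_dense hφ.norm_multiplier_le dense_span_range_U <|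
    Set.forall_mem_range.2 fun x => ⟨φ x, hφ.norm_le_one x, hφ.multiplier_U x⟩

theorem tendsto_norm_multiplier_iterate_sub (hφ : IsNormalizedPosDef φ)
    (a : reducedCStarAlgebra G) :
    Tendsto (fun n => ‖hφ.multiplier^[n] a -
      hφ.multiplier^[n] (subgroupExpectation hφ.peripheralSubgroup a)‖) atTop (𝓝 0) := by
  refine tendsto_norm_iterate_sub (T := hφ.multiplier.toLinearMap)
    (E := (subgroupExpectation hφ.peripheralSubgroup).toLinearMap) hφ.norm_multiplier_le
    (norm_subgroupExpectation_le _) dense_span_range_U (Set.forall_mem_range.2 fun x => ?_) a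
  exact (hφ.norm_le_one x).eq_or_lt.imp subgroupExpectation_U_of_mem fun hx =>
    ⟨subgroupExpectation_U_of_notMem hx.ne, φ x, hx, hφ.multiplier_U x⟩

theorem eq_subgroupExpectation (hφ : IsNormalizedPosDef φ)
    {E : reducedCStarAlgebra G →CP reducedCStarAlgebra G}
    (hE : ∀ x, (‖φ x‖ = 1 → E (U x) = U x) ∧ (‖φ x‖ < 1 → E (U x) = 0)) :
    E = subgroupExpectation hφ.peripheralSubgroup := by
  refine completelyPositiveMap_ext fun x => ?_
  rcases (hφ.norm_le_one x).eq_or_lt with hx | hx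
  · exact ((hE x).1 hx).trans (subgroupExpectation_U_of_mem hx).symm
  · exact ((hE x).2 hx).trans (subgroupExpectation_U_of_notMem hx.ne).symm

end IsNormalizedPosDef

end Multiplier

end ReducedGroup

end

theorem proposition4p2_general {G : Type*} [Group G] {φ : G → ℂ} (hφ : IsNormalizedPosDef φ) :
    ∃ P : reducedCStarAlgebra G →CP reducedCStarAlgebra G,
      (∀ x : G, P (U x) = φ x • U x) ∧
      (∀ P' : reducedCStarAlgebra G →CP reducedCStarAlgebra G,
        (∀ x : G, P' (U x) = φ x • U x) → P' = P) ∧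
      IsLocallyFiniteContraction P.toLinearMap ∧
      ∃ α : subgroupAlgebra hφ.peripheralSubgroup ≃⋆ₐ[ℂ] subgroupAlgebra hφ.peripheralSubgroup,
        (∀ b : subgroupAlgebra hφ.peripheralSubgroup, (α b : reducedCStarAlgebra G) = P b) ∧
        ∃ E : reducedCStarAlgebra G →CP reducedCStarAlgebra G,
          (∀ x : G, (‖φ x‖ = 1 → E (U x) = U x) ∧ (‖φ x‖ < 1 → E (U x) = 0)) ∧
          (∀ E' : reducedCStarAlgebra G →CP reducedCStarAlgebra G,
            (∀ x : G, (‖φ x‖ = 1 → E' (U x) = U x) ∧ (‖φ x‖ < 1 → E' (U x) = 0)) → E' = E) ∧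
          (∀ a : reducedCStarAlgebra G, E (E a) = E a) ∧
          Set.range E = (subgroupAlgebra hφ.peripheralSubgroup : Set (reducedCStarAlgebra G)) ∧
          ∃ hE : ∀ a : reducedCStarAlgebra G, E a ∈ subgroupAlgebra hφ.peripheralSubgroup,
            ∀ a : reducedCStarAlgebra G,
              Tendsto (fun n : ℕ => ‖P^[n] a - ((α ^ n) ⟨E a, hE a⟩ : reducedCStarAlgebra G)‖)
                atTop (𝓝 0) := by
  let N := hφ.peripheralSubgroup
  refine ⟨hφ.multiplier, hφ.multiplier_U, fun P' hP' => ?_,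
    hφ.isLocallyFiniteContraction_multiplier, hφ.peripheralAut, fun _ => rfl,
    subgroupExpectation N, fun x => ?_, fun E' hE' => hφ.eq_subgroupExpectation hE', fun a => ?_,
    range_subgroupExpectation N, subgroupExpectation_mem N, fun a => ?_⟩
  · exact completelyPositiveMap_ext fun x => (hP' x).trans (hφ.multiplier_U x).symm
  · exact ⟨fun hx => subgroupExpectation_U_of_mem hx,
      fun hx => subgroupExpectation_U_of_notMem hx.ne⟩
  · exact subgroupExpectation_eq_self (subgroupExpectation_mem N a)
  · simpa only [hφ.coe_peripheralAut_pow] using hφ.tendsto_norm_multiplier_iterate_sub a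

theorem proposition4p2 {G : Type*} [Group G]
    (ρ : reducedCStarAlgebra G →ₚ[ℂ] ℂ) (hρ : ρ 1 = 1) :
    ∃ P : reducedCStarAlgebra G →CP reducedCStarAlgebra G,
      (∀ x : G, P (U x) = ρ (U x) • U x) ∧
      (∀ P' : reducedCStarAlgebra G →CP reducedCStarAlgebra G,
        (∀ x : G, P' (U x) = ρ (U x) • U x) → P' = P) ∧
      IsLocallyFiniteContraction P.toLinearMap ∧
      ∃ α : peripheralSubalgebra ρ ≃⋆ₐ[ℂ] peripheralSubalgebra ρ,
        (∀ b : peripheralSubalgebra ρ,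
          ((α b : peripheralSubalgebra ρ) : reducedCStarAlgebra G) = P b) ∧
        ∃ E : reducedCStarAlgebra G →CP reducedCStarAlgebra G,
          (∀ x : G, (‖ρ (U x)‖ = 1 → E (U x) = U x) ∧ (‖ρ (U x)‖ < 1 → E (U x) = 0)) ∧
          (∀ E' : reducedCStarAlgebra G →CP reducedCStarAlgebra G,
            (∀ x : G, (‖ρ (U x)‖ = 1 → E' (U x) = U x) ∧ (‖ρ (U x)‖ < 1 → E' (U x) = 0)) →
              E' = E) ∧
          (∀ a : reducedCStarAlgebra G, E (E a) = E a) ∧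
          Set.range E = (peripheralSubalgebra ρ : Set (reducedCStarAlgebra G)) ∧
          ∃ hE : ∀ a : reducedCStarAlgebra G, E a ∈ peripheralSubalgebra ρ,
            ∀ a : reducedCStarAlgebra G,
              Tendsto (fun n : ℕ =>
                ‖(P : reducedCStarAlgebra G → reducedCStarAlgebra G)^[n] a -
                  (((α ^ n) ⟨E a, hE a⟩ : peripheralSubalgebra ρ) : reducedCStarAlgebra G)‖)
                atTop (𝓝 0) :=
  proposition4p2_general (isNormalizedPosDef_state hρ)
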